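/- Let $a>0$ and let $Q$ be the surface of a cube of side length $a$ in $\mathbb{R}^3$, that is, the union of its six closed square faces. Let $S$ and $T$ be points in the relative interiors of two opposite faces. A shortest surface path from $S$ to $T$ is a continuous path from $S$ to $T$ contained in $Q$ whose Euclidean length is minimal among all such paths. A path $\gamma:[0,1]\to Q$ is said to traverse exactly $k$ faces if there are $k$ distinct faces $F_1,\dots,F_k$ and times $0=b_0<b_1<\dots<b_k=1$ such that, for each $i$, the restriction of $\gamma$ to $[b_{i-1},b_i]$ stays in the closed face $F_i$ and meets the relative interior of $F_i$, and $\gamma$ meets no (closed) face other than $F_1,\dots,F_k$. Then every shortest surface path from $S$ to $T$ traverses exactly three or exactly four faces. In particular, no shortest surface path from $S$ to $T$ traverses exactly five or exactly six faces. -/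

import Mathlib

/-- Euclidean three-space. -/
abbrev Space : Type := EuclideanSpace ℝ (Fin 3)

/-- Labels of the six faces of the cube `[0, a]³`: the face `(i, false)` lies in the plane
`x i = 0` and the face `(i, true)` lies in the plane `x i = a`. -/
abbrev CubeFace : Type := Fin 3 × Bool

namespace CubeFace

/-- The opposite face. -/
def opposite (F : CubeFace) : CubeFace := (F.1, !F.2)

/-- The constant value that the coordinate `x F.1` has on the face `F`. -/
def height (a : ℝ) (F : CubeFace) : ℝ := if F.2 then a else 0

/-- The closed square of the cube `[0, a]³` labelled by `F`. -/
def carrier (a : ℝ) (F : CubeFace) : Set Space :=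
  {x | x F.1 = F.height a ∧ ∀ j, x j ∈ Set.Icc 0 a}

/-- The relative interior of the face `F` (the points of the face on no edge of the cube). -/
def interior (a : ℝ) (F : CubeFace) : Set Space :=
  {x | x F.1 = F.height a ∧ ∀ j, j ≠ F.1 → x j ∈ Set.Ioo 0 a}

end CubeFace

/-- The surface of the cube `[0, a]³`: the union of its six closed faces. -/
def cubeSurface (a : ℝ) : Set Space := ⋃ F : CubeFace, F.carrier a

/-- The path `γ` stays on the surface of the cube `[0, a]³`. -/
def IsSurfacePath (a : ℝ) {s t : Space} (γ : Path s t) : Prop :=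
  ∀ τ, γ τ ∈ cubeSurface a

/-- The length of a path: its total variation for the Euclidean distance (possibly infinite). -/
noncomputable def pathLength {s t : Space} (γ : Path s t) : ENNReal :=
  eVariationOn (γ : unitInterval → Space) Set.univ

/-- `γ` is a shortest path on the surface of the cube `[0, a]³` between its endpoints, among all
continuous paths on the surface. -/
def IsShortestSurfacePath (a : ℝ) {s t : Space} (γ : Path s t) : Prop :=
  IsSurfacePath a γ ∧ ∀ δ : Path s t, IsSurfacePath a δ → pathLength γ ≤ pathLength δ

/-- `γ` traverses exactly `k` faces: there are `k` different faces `F 0, …, F (k - 1)` and times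
`0 = b 0 < b 1 < ⋯ < b k = 1` such that, during the time interval `[b i, b (i + 1)]`, the path
stays in the closed face `F i` and passes through its relative interior; and the path does not
meet any further face, not even in a point of an edge. -/
def TraversesExactly (a : ℝ) {s t : Space} (γ : Path s t) (k : ℕ) : Prop :=
  ∃ (F : Fin k → CubeFace) (b : Fin (k + 1) → unitInterval),
    Function.Injective F ∧
    StrictMono b ∧ b 0 = 0 ∧ b (Fin.last k) = 1 ∧
    (∀ i : Fin k, ∀ τ ∈ Set.Icc (b i.castSucc) (b i.succ), γ τ ∈ (F i).carrier a) ∧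
    (∀ i : Fin k, ∃ τ ∈ Set.Icc (b i.castSucc) (b i.succ), γ τ ∈ (F i).interior a) ∧
    ∀ G : CubeFace, (∃ τ, γ τ ∈ G.carrier a) → ∃ i, F i = G

/-! A stretch of a shortest path between points on faces `A` and `B` is no longer than two segments
through a common point of `A` and `B`; `IsShortestSurfacePath.eVariationOn_le` proves this by
surgery on the path. With `A = B`, the path is straight between any two of its points on one face,
so it never leaves a face and returns to it.

Two unfoldings do the rest. A path through a vertex can be shortened by unfolding two faces at that
vertex (`IsShortestSurfacePath.not_mem_three_carriers`), so at each moment the path meets at most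
two faces. And a path that leaves the first face `F` through `G` and crosses a lateral face `H` to
the face opposite `G` can be rerouted from `F` straight into `H` at no extra cost. In the case of
equality the reroute would be straight inside `F` although it touches an edge of `F` midway, which
is impossible when it starts in the interior (`IsShortestSurfacePath.not_cross_two_sides`).

Hence between `F` and its opposite the path uses one lateral face or two adjacent ones. The
breakpoints are last times on one face and first times on another, because a path may pause. -/

/-! ### Lengths of concatenations, segments and subpaths. -/

theorem pathLength_trans_le {x y z : Space} (γ : Path x y) (γ' : Path y z) :
    pathLength (γ.trans γ') ≤ pathLength γ + pathLength γ' := by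
  have hz : (0 : ℝ) ≤ 1 := zero_le_one
  let m : unitInterval := ⟨1 / 2, by norm_num, by norm_num⟩
  have hsplit := eVariationOn.Icc_add_Icc (γ.trans γ') (s := Set.univ) (a := 0) (b := m) (c := 1)
    m.2.1 m.2.2 (Set.mem_univ _)
  simp only [Set.univ_inter] at hsplit
  have huniv : (Set.Icc 0 1 : Set unitInterval) = Set.univ :=
    Set.eq_univ_of_forall fun t => ⟨t.2.1, t.2.2⟩
  rw [huniv] at hsplit
  rw [pathLength, ← hsplit]
  refine add_le_add ?_ ?_
  · let φ : unitInterval → unitInterval := fun t => Set.projIcc 0 1 hz (2 * t)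
    have hφ : Monotone φ := fun s t hst => Set.monotone_projIcc hz (by
      have : (s : ℝ) ≤ t := hst
      linarith)
    rw [eVariationOn.congr (g := γ ∘ φ)]
    · exact eVariationOn.comp_le_of_monotoneOn _ φ (hφ.monotoneOn _) fun _ _ => Set.mem_univ _
    · intro t ht
      have ht' : (t : ℝ) ≤ 1 / 2 := ht.2
      simp only [Path.trans_apply, dif_pos ht', Function.comp_apply, φ]
      congr 1
      exact (Set.projIcc_of_mem hz (x := 2 * (t : ℝ)) ⟨by linarith [t.2.1], by linarith⟩).symm
  · let φ : unitInterval → unitInterval := fun t => Set.projIcc 0 1 hz (2 * t - 1)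
    have hφ : Monotone φ := fun s t hst => Set.monotone_projIcc hz (by
      have : (s : ℝ) ≤ t := hst
      linarith)
    rw [eVariationOn.congr (g := γ' ∘ φ)]
    · exact eVariationOn.comp_le_of_monotoneOn _ φ (hφ.monotoneOn _) fun _ _ => Set.mem_univ _
    · intro t ht
      have ht' : 1 / 2 ≤ (t : ℝ) := ht.1
      have ht1 : (t : ℝ) ≤ 1 := t.2.2
      -- At time `1/2`, `Path.trans` is defined by its first branch, so the common endpoint `y` has
      -- to be matched by hand.
      rcases ht'.eq_or_lt with h | h
      · simp only [Path.trans_apply, dif_pos h.symm.le, Function.comp_apply, φ]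
        have h1 : (⟨2 * (t : ℝ), (unitInterval.mul_pos_mem_iff zero_lt_two).2
            ⟨t.2.1, h.symm.le⟩⟩ : unitInterval) = 1 := Subtype.ext (by simp; linarith)
        have h2 : Set.projIcc 0 1 hz (2 * (t : ℝ) - 1) = 0 :=
          Set.projIcc_of_le_left hz (by linarith)
        rw [h1, h2, γ.target, γ'.source]
      · simp only [Path.trans_apply, dif_neg (not_le.2 h), Function.comp_apply, φ]
        congr 1
        exact (Set.projIcc_of_mem hz (x := 2 * (t : ℝ) - 1) ⟨by linarith, by linarith⟩).symm

theorem pathLength_segment_le (x y : Space) : pathLength (Path.segment x y) ≤ edist x y := by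
  have hmono : Monotone ((↑) : unitInterval → ℝ) := fun _ _ h => h
  have hL : LipschitzOnWith (nndist x y) (AffineMap.lineMap x y : ℝ → Space) Set.univ :=
    (lipschitzWith_lineMap x y).lipschitzOnWith
  have h := hL.comp_eVariationOn_le (g := ((↑) : unitInterval → ℝ)) (s := Set.univ)
    fun _ _ => Set.mem_univ _
  have h1 : eVariationOn ((↑) : unitInterval → ℝ) Set.univ ≤ 1 := by
    have h2 := ((hmono.monotoneOn Set.univ).eVariationOn_eq (Set.mem_univ 0) (Set.mem_univ 1)).le
    have huniv : (Set.Icc 0 1 : Set unitInterval) = Set.univ :=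
      Set.eq_univ_of_forall fun t => ⟨t.2.1, t.2.2⟩
    simpa [huniv] using h2
  calc pathLength (Path.segment x y)
      = eVariationOn ((AffineMap.lineMap x y : ℝ → Space) ∘ ((↑) : unitInterval → ℝ))
          Set.univ := rfl
    _ ≤ nndist x y * eVariationOn ((↑) : unitInterval → ℝ) Set.univ := h
    _ ≤ nndist x y * 1 := by gcongr
    _ = edist x y := by rw [mul_one, edist_nndist]

theorem pathLength_subpath_le {x y : Space} (γ : Path x y) {σ τ : unitInterval} (h : σ ≤ τ) :
    pathLength (γ.subpath σ τ) ≤ eVariationOn γ (Set.Icc σ τ) := by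
  refine eVariationOn.comp_le_of_monotoneOn γ (Set.Icc.convexComb σ τ) ?_ ?_
  · intro r _ u _ hru
    have h1 : (r : ℝ) ≤ u := hru
    have h2 : (σ : ℝ) ≤ τ := h
    change (1 - (r : ℝ)) * σ + r * τ ≤ (1 - (u : ℝ)) * σ + u * τ
    nlinarith
  · intro r _
    have h2 : (σ : ℝ) ≤ τ := h
    have h3 : (0 : ℝ) ≤ r := r.2.1
    have h4 : (r : ℝ) ≤ 1 := r.2.2
    constructor
    · change (σ : ℝ) ≤ (1 - (r : ℝ)) * σ + r * τ
      nlinarith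
    · change (1 - (r : ℝ)) * σ + r * τ ≤ (τ : ℝ)
      nlinarith

/-! ### Faces are closed and convex; paths on the surface. -/

theorem CubeFace.carrier_subset_cubeSurface (a : ℝ) (A : CubeFace) :
    A.carrier a ⊆ cubeSurface a :=
  Set.subset_iUnion (fun F : CubeFace => F.carrier a) A

theorem CubeFace.convex_carrier (a : ℝ) (A : CubeFace) : Convex ℝ (A.carrier a) := by
  have hE : A.carrier a = (fun x : Space => x A.1) ⁻¹' {A.height a} ∩
      ⋂ j, (fun x : Space => x j) ⁻¹' Set.Icc 0 a := by
    ext x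
    simp [CubeFace.carrier]
  rw [hE]
  exact ((convex_singleton _).is_linear_preimage (EuclideanSpace.proj A.1).isLinear).inter
    (convex_iInter fun j => (convex_Icc _ _).is_linear_preimage (EuclideanSpace.proj j).isLinear)

theorem CubeFace.isClosed_carrier (a : ℝ) (A : CubeFace) : IsClosed (A.carrier a) := by
  have hE : A.carrier a = (fun x : Space => x A.1) ⁻¹' {A.height a} ∩
      ⋂ j, (fun x : Space => x j) ⁻¹' Set.Icc 0 a := by
    ext x
    simp [CubeFace.carrier]
  rw [hE]
  exact (isClosed_singleton.preimage (by fun_prop)).inter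
    (isClosed_iInter fun j => isClosed_Icc.preimage (by fun_prop))

theorem isSurfacePath_trans {a : ℝ} {x y z : Space} {γ : Path x y} {γ' : Path y z}
    (h : IsSurfacePath a γ) (h' : IsSurfacePath a γ') : IsSurfacePath a (γ.trans γ') := by
  intro τ
  rw [Path.trans_apply]
  split_ifs
  · exact h _
  · exact h' _

theorem isSurfacePath_segment {a : ℝ} {x y : Space} {A : CubeFace} (hx : x ∈ A.carrier a)
    (hy : y ∈ A.carrier a) : IsSurfacePath a (Path.segment x y) := by
  intro τ
  refine A.carrier_subset_cubeSurface a ((A.convex_carrier a).segment_subset hx hy ?_)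
  rw [← Path.range_segment]
  exact Set.mem_range_self τ

theorem isSurfacePath_subpath {a : ℝ} {x y : Space} {γ : Path x y} (h : IsSurfacePath a γ)
    (σ τ : unitInterval) : IsSurfacePath a (γ.subpath σ τ) := fun _ => h _

theorem eVariationOn_path_add {x y : Space} (γ : Path x y) {r σ τ : unitInterval} (h : r ≤ σ)
    (h' : σ ≤ τ) : eVariationOn γ (Set.Icc r σ) + eVariationOn γ (Set.Icc σ τ) =
      eVariationOn γ (Set.Icc r τ) := by
  simpa using eVariationOn.Icc_add_Icc γ (s := Set.univ) h h' (Set.mem_univ _)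

/-! ### Surgery on shortest paths and straightness within a face. -/

/-- The part of a shortest path between two times is no longer than any detour
through two faces that share a point. -/
theorem IsShortestSurfacePath.eVariationOn_le {a : ℝ} {s t : Space} {γ : Path s t}
    (hγ : IsShortestSurfacePath a γ) (hfin : pathLength γ ≠ ⊤) {σ τ : unitInterval} (hστ : σ ≤ τ)
    {A B : CubeFace} {e : Space} (hA : γ σ ∈ A.carrier a) (heA : e ∈ A.carrier a)
    (heB : e ∈ B.carrier a) (hB : γ τ ∈ B.carrier a) :
    eVariationOn γ (Set.Icc σ τ) ≤ edist (γ σ) e + edist e (γ τ) := by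
  let δ : Path s t := ((((γ.subpath 0 σ).trans ((Path.segment (γ σ) e).trans
    (Path.segment e (γ τ)))).trans (γ.subpath τ 1)).cast γ.source.symm γ.target.symm)
  have hδ : IsSurfacePath a δ := isSurfacePath_trans (isSurfacePath_trans
    (isSurfacePath_subpath hγ.1 _ _)
    (isSurfacePath_trans (isSurfacePath_segment hA heA) (isSurfacePath_segment heB hB)))
    (isSurfacePath_subpath hγ.1 _ _)
  have h0 : (0 : unitInterval) ≤ σ := σ.2.1
  have h1 : τ ≤ (1 : unitInterval) := τ.2.2
  have hup : pathLength δ ≤ eVariationOn γ (Set.Icc 0 σ) + (edist (γ σ) e + edist e (γ τ)) +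
      eVariationOn γ (Set.Icc τ 1) := by
    refine (pathLength_trans_le _ _).trans (add_le_add ((pathLength_trans_le _ _).trans
      (add_le_add (pathLength_subpath_le γ h0) ((pathLength_trans_le _ _).trans
        (add_le_add (pathLength_segment_le _ _) (pathLength_segment_le _ _)))))
          (pathLength_subpath_le γ h1))
  have huniv : (Set.Icc 0 1 : Set unitInterval) = Set.univ :=
    Set.eq_univ_of_forall fun t => ⟨t.2.1, t.2.2⟩
  have hlen : pathLength γ = eVariationOn γ (Set.Icc 0 σ) + eVariationOn γ (Set.Icc σ τ) +
      eVariationOn γ (Set.Icc τ 1) := by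
    rw [eVariationOn_path_add γ h0 hστ, eVariationOn_path_add γ (h0.trans hστ) h1, huniv,
      pathLength]
  have hle := (hγ.2 δ hδ).trans hup
  rw [hlen] at hle
  -- Finiteness allows the unchanged outer pieces to be cancelled in `ENNReal`.
  have hne : ∀ u : Set unitInterval, eVariationOn γ u ≠ ⊤ := fun u =>
    ne_top_of_le_ne_top hfin (eVariationOn.mono _ (Set.subset_univ u))
  exact (ENNReal.add_le_add_iff_left (hne _)).1 ((ENNReal.add_le_add_iff_right (hne _)).1 hle)

theorem IsShortestSurfacePath.dist_add_dist_le {a : ℝ} {s t : Space} {γ : Path s t}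
    (hγ : IsShortestSurfacePath a γ) (hfin : pathLength γ ≠ ⊤) {σ ρ τ : unitInterval}
    (hσρ : σ ≤ ρ) (hρτ : ρ ≤ τ) {A B : CubeFace} {e : Space} (hA : γ σ ∈ A.carrier a)
    (heA : e ∈ A.carrier a) (heB : e ∈ B.carrier a) (hB : γ τ ∈ B.carrier a) :
    dist (γ σ) (γ ρ) + dist (γ ρ) (γ τ) ≤ dist (γ σ) e + dist e (γ τ) := by
  have h := hγ.eVariationOn_le hfin (hσρ.trans hρτ) hA heA heB hB
  rw [← eVariationOn_path_add γ hσρ hρτ] at h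
  have h2 := (add_le_add (eVariationOn.edist_le γ (Set.left_mem_Icc.2 hσρ)
    (Set.right_mem_Icc.2 hσρ)) (eVariationOn.edist_le γ (Set.left_mem_Icc.2 hρτ)
    (Set.right_mem_Icc.2 hρτ))).trans h
  simp only [edist_dist] at h2
  rw [← ENNReal.ofReal_add dist_nonneg dist_nonneg, ← ENNReal.ofReal_add dist_nonneg dist_nonneg,
    ENNReal.ofReal_le_ofReal_iff (by positivity)] at h2
  exact h2

theorem IsShortestSurfacePath.dist_add_dist_add_dist_le {a : ℝ} {s t : Space} {γ : Path s t}
    (hγ : IsShortestSurfacePath a γ) (hfin : pathLength γ ≠ ⊤) {σ ρ π τ : unitInterval}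
    (hσρ : σ ≤ ρ) (hρπ : ρ ≤ π) (hπτ : π ≤ τ) {A B : CubeFace} {e : Space}
    (hA : γ σ ∈ A.carrier a) (heA : e ∈ A.carrier a) (heB : e ∈ B.carrier a)
    (hB : γ τ ∈ B.carrier a) :
    dist (γ σ) (γ ρ) + dist (γ ρ) (γ π) + dist (γ π) (γ τ) ≤ dist (γ σ) e + dist e (γ τ) := by
  have h := hγ.eVariationOn_le hfin ((hσρ.trans hρπ).trans hπτ) hA heA heB hB
  rw [← eVariationOn_path_add γ (hσρ.trans hρπ) hπτ, ← eVariationOn_path_add γ hσρ hρπ] at h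
  have h2 := (add_le_add (add_le_add (eVariationOn.edist_le γ (Set.left_mem_Icc.2 hσρ)
    (Set.right_mem_Icc.2 hσρ)) (eVariationOn.edist_le γ (Set.left_mem_Icc.2 hρπ)
    (Set.right_mem_Icc.2 hρπ))) (eVariationOn.edist_le γ (Set.left_mem_Icc.2 hπτ)
    (Set.right_mem_Icc.2 hπτ))).trans h
  simp only [edist_dist] at h2
  rw [← ENNReal.ofReal_add dist_nonneg dist_nonneg, ← ENNReal.ofReal_add dist_nonneg dist_nonneg,
    ← ENNReal.ofReal_add (by positivity) dist_nonneg,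
    ENNReal.ofReal_le_ofReal_iff (by positivity)] at h2
  exact h2

/-- On a shortest path, the part between two points of one face is a straight segment. -/
theorem IsShortestSurfacePath.mem_segment {a : ℝ} {s t : Space} {γ : Path s t}
    (hγ : IsShortestSurfacePath a γ) (hfin : pathLength γ ≠ ⊤) {σ ρ τ : unitInterval}
    (hσρ : σ ≤ ρ) (hρτ : ρ ≤ τ) {A : CubeFace} (hA : γ σ ∈ A.carrier a)
    (hB : γ τ ∈ A.carrier a) : γ ρ ∈ segment ℝ (γ σ) (γ τ) := by
  rw [mem_segment_iff_wbtw, ← dist_add_dist_eq_iff]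
  refine le_antisymm ?_ (dist_triangle _ _ _)
  simpa using hγ.dist_add_dist_le hfin hσρ hρτ hA hA hA hB

theorem IsShortestSurfacePath.mem_carrier {a : ℝ} {s t : Space} {γ : Path s t}
    (hγ : IsShortestSurfacePath a γ) (hfin : pathLength γ ≠ ⊤) {σ ρ τ : unitInterval}
    (hσρ : σ ≤ ρ) (hρτ : ρ ≤ τ) {A : CubeFace} (hA : γ σ ∈ A.carrier a)
    (hB : γ τ ∈ A.carrier a) : γ ρ ∈ A.carrier a :=
  (A.convex_carrier a).segment_subset hA hB (hγ.mem_segment hfin hσρ hρτ hA hB)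

/-- Just after each time before the end, a shortest path stays in one face. -/
theorem IsShortestSurfacePath.exists_carrier_right {a : ℝ} {s t : Space} {γ : Path s t}
    (hγ : IsShortestSurfacePath a γ) {σ : unitInterval}
    (hσ : σ < 1) : ∃ A : CubeFace, γ σ ∈ A.carrier a ∧ ∃ τ, σ < τ ∧ γ τ ∈ A.carrier a := by
  have : (nhdsWithin σ (Set.Ioi σ)).NeBot := nhdsGT_neBot_of_exists_gt ⟨1, hσ⟩
  have h1 : ∃ᶠ τ in nhdsWithin σ (Set.Ioi σ), ∃ A : CubeFace, γ τ ∈ A.carrier a :=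
    Filter.Eventually.frequently (Filter.Eventually.of_forall fun τ => Set.mem_iUnion.1 (hγ.1 τ))
  -- There are finitely many faces, so a single one is met at times arbitrarily close to `σ`; being
  -- closed, it also contains `γ σ`.
  obtain ⟨A, hA⟩ := Filter.frequently_exists.1 h1
  refine ⟨A, ?_, ?_⟩
  · have h2 : ∃ᶠ τ in nhds σ, τ ∈ γ ⁻¹' A.carrier a := hA.filter_mono nhdsWithin_le_nhds
    exact ((A.isClosed_carrier a).preimage γ.continuous).mem_of_frequently_of_tendsto h2
      Filter.tendsto_id
  · obtain ⟨τ, h2, h3⟩ := (hA.and_eventually self_mem_nhdsWithin).exists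
    exact ⟨τ, h3, h2⟩

/-- Just before each time after the start, a shortest path stays in one face. -/
theorem IsShortestSurfacePath.exists_carrier_left {a : ℝ} {s t : Space} {γ : Path s t}
    (hγ : IsShortestSurfacePath a γ) {σ : unitInterval}
    (hσ : 0 < σ) : ∃ A : CubeFace, γ σ ∈ A.carrier a ∧ ∃ τ, τ < σ ∧ γ τ ∈ A.carrier a := by
  have : (nhdsWithin σ (Set.Iio σ)).NeBot := nhdsLT_neBot_of_exists_lt ⟨0, hσ⟩
  have h1 : ∃ᶠ τ in nhdsWithin σ (Set.Iio σ), ∃ A : CubeFace, γ τ ∈ A.carrier a :=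
    Filter.Eventually.frequently (Filter.Eventually.of_forall fun τ => Set.mem_iUnion.1 (hγ.1 τ))
  obtain ⟨A, hA⟩ := Filter.frequently_exists.1 h1
  refine ⟨A, ?_, ?_⟩
  · have h2 : ∃ᶠ τ in nhds σ, τ ∈ γ ⁻¹' A.carrier a := hA.filter_mono nhdsWithin_le_nhds
    exact ((A.isClosed_carrier a).preimage γ.continuous).mem_of_frequently_of_tendsto h2
      Filter.tendsto_id
  · obtain ⟨τ, h2, h3⟩ := (hA.and_eventually self_mem_nhdsWithin).exists
    exact ⟨τ, h3, h2⟩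

/-! ### Depth coordinates and incidence of faces. -/

/-- The distance of a point of the cube `[0, a]³` to the plane of a face. -/
def CubeFace.depth (a : ℝ) (A : CubeFace) (x : Space) : ℝ := if A.2 then a - x A.1 else x A.1

theorem CubeFace.mem_carrier_iff {a : ℝ} {A : CubeFace} {x : Space} :
    x ∈ A.carrier a ↔ A.depth a x = 0 ∧ ∀ j, x j ∈ Set.Icc 0 a := by
  obtain ⟨i, b⟩ := A
  cases b <;> simp [CubeFace.carrier, CubeFace.depth, CubeFace.height, sub_eq_zero,
    eq_comm (a := a)]

theorem CubeFace.depth_eq_zero {a : ℝ} {A : CubeFace} {x : Space} (h : x ∈ A.carrier a) :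
    A.depth a x = 0 := (CubeFace.mem_carrier_iff.1 h).1

theorem CubeFace.depth_nonneg {a : ℝ} {x : Space} (hx : ∀ j, x j ∈ Set.Icc 0 a) (A : CubeFace) :
    0 ≤ A.depth a x := by
  obtain ⟨i, b⟩ := A
  cases b
  · simpa [CubeFace.depth] using (hx i).1
  · simpa [CubeFace.depth] using (hx i).2

theorem CubeFace.depth_le {a : ℝ} {x : Space} (hx : ∀ j, x j ∈ Set.Icc 0 a) (A : CubeFace) :
    A.depth a x ≤ a := by
  obtain ⟨i, b⟩ := A
  cases b
  · simpa [CubeFace.depth] using (hx i).2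
  · simpa [CubeFace.depth] using (hx i).1

theorem CubeFace.depth_pos {a : ℝ} {x : Space} (hx : ∀ j, x j ∈ Set.Icc 0 a) {A : CubeFace}
    (h : x ∉ A.carrier a) : 0 < A.depth a x :=
  lt_of_le_of_ne (A.depth_nonneg hx) fun h0 => h (CubeFace.mem_carrier_iff.2 ⟨h0.symm, hx⟩)

theorem CubeFace.depth_add_depth {a : ℝ} {A B : CubeFace} (hAB : A ≠ B) (h : A.1 = B.1)
    (x : Space) : A.depth a x + B.depth a x = a := by
  obtain ⟨i, b⟩ := A
  obtain ⟨j, c⟩ := B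
  obtain rfl : i = j := h
  cases b <;> cases c <;> simp_all [CubeFace.depth]

theorem CubeFace.axis_ne {a : ℝ} (ha : 0 < a) {A B : CubeFace} {x : Space}
    (hA : x ∈ A.carrier a) (hB : x ∈ B.carrier a) (hAB : A ≠ B) : A.1 ≠ B.1 := by
  intro h
  have := CubeFace.depth_add_depth (a := a) hAB h x
  rw [CubeFace.depth_eq_zero hA, CubeFace.depth_eq_zero hB] at this
  linarith

/-- Each depth is a coordinate up to sign and shift, so three faces with distinct axes give
orthonormal coordinates adapted to them. -/
theorem dist_sq_eq_depth (a : ℝ) {A B C : CubeFace} (hAB : A.1 ≠ B.1) (hAC : A.1 ≠ C.1)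
    (hBC : B.1 ≠ C.1) (x y : Space) :
    dist x y ^ 2 = (A.depth a x - A.depth a y) ^ 2 + (B.depth a x - B.depth a y) ^ 2 +
      (C.depth a x - C.depth a y) ^ 2 := by
  have hd : ∀ G : CubeFace, (G.depth a x - G.depth a y) ^ 2 = (x G.1 - y G.1) ^ 2 := by
    rintro ⟨i, b⟩
    cases b <;> simp [CubeFace.depth]
    ring
  rw [hd, hd, hd, EuclideanSpace.dist_sq_eq]
  simp only [Real.dist_eq, sq_abs]
  have huniv : (Finset.univ : Finset (Fin 3)) = {A.1, B.1, C.1} := by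
    symm
    rw [← Finset.card_eq_iff_eq_univ, Finset.card_eq_three.2 ⟨_, _, _, hAB, hAC, hBC, rfl⟩]
    rfl
  rw [huniv, Finset.sum_insert (by simp [hAB, hAC]), Finset.sum_pair hBC, add_assoc]

theorem exists_depth_eq_of_mem_segment (a : ℝ) {x y z : Space} (hz : z ∈ segment ℝ x y) :
    ∃ u v : ℝ, 0 ≤ u ∧ 0 ≤ v ∧ u + v = 1 ∧ u • x + v • y = z ∧
      ∀ A : CubeFace, A.depth a z = u * A.depth a x + v * A.depth a y := by
  obtain ⟨u, v, hu, hv, huv, rfl⟩ := hz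
  refine ⟨u, v, hu, hv, huv, rfl, ?_⟩
  rintro ⟨i, b⟩
  cases b
  · simp [CubeFace.depth]
  · simp [CubeFace.depth]
    linear_combination -a * huv

/-- A segment in the cube that meets a face outside its second endpoint starts in this face. -/
theorem CubeFace.mem_carrier_left_of_mem_segment {a : ℝ} {x y z : Space}
    (hx : ∀ j, x j ∈ Set.Icc 0 a) (hy : ∀ j, y j ∈ Set.Icc 0 a) (hz : z ∈ segment ℝ x y)
    {A : CubeFace} (hA : z ∈ A.carrier a) (hne : z ≠ y) : x ∈ A.carrier a := by
  by_contra hxA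
  obtain ⟨u, v, hu, hv, huv, hzE, hd⟩ := exists_depth_eq_of_mem_segment a hz
  have h0 := hd A
  rw [CubeFace.depth_eq_zero hA] at h0
  have h1 := CubeFace.depth_pos hx hxA
  have h2 := A.depth_nonneg hy
  -- Depth is nonnegative on the cube and positive at `x`, so its vanishing at `z` leaves no weight
  -- on `x`.
  have hu0 : u = 0 := by
    by_contra hne0
    have := mul_pos (lt_of_le_of_ne hu (Ne.symm hne0)) h1
    have := mul_nonneg hv h2
    linarith
  subst hu0
  obtain rfl : v = 1 := by linarith
  exact hne (by simpa using hzE.symm)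

theorem CubeFace.interior_subset_carrier {a : ℝ} (ha : 0 ≤ a) (A : CubeFace) :
    A.interior a ⊆ A.carrier a := by
  rintro x ⟨h1, h2⟩
  refine ⟨h1, fun j => ?_⟩
  by_cases h : j = A.1
  · subst h
    rw [h1, CubeFace.height]
    split_ifs
    · exact ⟨ha, le_rfl⟩
    · exact ⟨le_rfl, ha⟩
  · exact Set.Ioo_subset_Icc_self (h2 j h)

theorem CubeFace.eq_of_mem_interior {a : ℝ} (ha : 0 < a) {A B : CubeFace} {x : Space}
    (hA : x ∈ A.interior a) (hB : x ∈ B.carrier a) : B = A := by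
  by_contra hne
  have h1 := CubeFace.axis_ne ha hB (A.interior_subset_carrier ha.le hA) hne
  have h2 := hA.2 _ h1
  rw [hB.1, CubeFace.height] at h2
  split_ifs at h2
  · exact lt_irrefl _ h2.2
  · exact lt_irrefl _ h2.1

theorem CubeFace.mem_interior {a : ℝ} {A : CubeFace} {x : Space} (hA : x ∈ A.carrier a)
    (h : ∀ B : CubeFace, x ∈ B.carrier a → B = A) : x ∈ A.interior a := by
  refine ⟨hA.1, fun j hj => ⟨lt_of_le_of_ne (hA.2 j).1 fun h0 => hj ?_,
    lt_of_le_of_ne (hA.2 j).2 fun h0 => hj ?_⟩⟩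
  · exact congrArg Prod.fst (h (j, false) ⟨h0.symm, hA.2⟩)
  · exact congrArg Prod.fst (h (j, true) ⟨h0, hA.2⟩)

/-- A face through a common point of three other faces is one of them. -/
theorem CubeFace.eq_or_eq_or_eq {a : ℝ} (ha : 0 < a) {A B C D : CubeFace} {x : Space}
    (hAB : A ≠ B) (hAC : A ≠ C) (hBC : B ≠ C) (hA : x ∈ A.carrier a) (hB : x ∈ B.carrier a)
    (hC : x ∈ C.carrier a) (hD : x ∈ D.carrier a) : D = A ∨ D = B ∨ D = C := by
  by_contra! h
  have h1 := CubeFace.axis_ne ha hA hB hAB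
  have h2 := CubeFace.axis_ne ha hA hC hAC
  have h3 := CubeFace.axis_ne ha hB hC hBC
  have h4 := CubeFace.axis_ne ha hD hA h.1
  have h5 := CubeFace.axis_ne ha hD hB h.2.1
  have h6 := CubeFace.axis_ne ha hD hC h.2.2
  omega

/-! ### Unfolding and its plane inequalities. -/

/-- Unfolding two adjacent faces into a plane: some point of the common edge is at least as good
as the straight segment in this plane. -/
theorem exists_dist_add_dist_le_unfold {a : ℝ} {A B C : CubeFace} (hAB : A.1 ≠ B.1)
    (hAC : A.1 ≠ C.1) (hBC : B.1 ≠ C.1) {p q : Space} (hp : p ∈ A.carrier a)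
    (hq : q ∈ B.carrier a) :
    ∃ e, e ∈ A.carrier a ∧ e ∈ B.carrier a ∧
      dist p e + dist e q ≤
        √((B.depth a p + A.depth a q) ^ 2 + (C.depth a p - C.depth a q) ^ 2) := by
  have hpA := CubeFace.depth_eq_zero hp
  have hqB := CubeFace.depth_eq_zero hq
  have h1 : 0 ≤ B.depth a p := B.depth_nonneg hp.2
  have h2 : 0 ≤ A.depth a q := A.depth_nonneg hq.2
  -- The unfolded segment meets the common edge in the ratio of the two depths. If both depths
  -- vanish, the points already lie on the edge and any weights would do.
  obtain ⟨u, v, hu, hv, huv, hur, hvr⟩ : ∃ u v : ℝ, 0 ≤ u ∧ 0 ≤ v ∧ u + v = 1 ∧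
      B.depth a p = v * (B.depth a p + A.depth a q) ∧
      A.depth a q = u * (B.depth a p + A.depth a q) := by
    rcases (add_nonneg h1 h2).eq_or_lt with h0 | h0
    · refine ⟨1, 0, zero_le_one, le_rfl, by norm_num, ?_, ?_⟩ <;> linarith
    · refine ⟨A.depth a q / (B.depth a p + A.depth a q), B.depth a p / (B.depth a p + A.depth a q),
        by positivity, by positivity, ?_, ?_, ?_⟩ <;> field_simp
      ring
  have hh : ∀ G : CubeFace, 0 ≤ a → G.height a ∈ Set.Icc 0 a := by
    intro G ha
    rw [CubeFace.height]
    split_ifs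
    · exact ⟨ha, le_rfl⟩
    · exact ⟨le_rfl, ha⟩
  have ha : 0 ≤ a := (hp.2 0).1.trans (hp.2 0).2
  let e : Space := WithLp.toLp 2 fun j => if j = A.1 then A.height a else
    if j = B.1 then B.height a else u * p j + v * q j
  have heA1 : e A.1 = A.height a := by simp [e]
  have heB1 : e B.1 = B.height a := by simp [e, hAB.symm]
  have heC1 : e C.1 = u * p C.1 + v * q C.1 := by simp [e, hAC.symm, hBC.symm]
  have hecube : ∀ j, e j ∈ Set.Icc 0 a := by
    intro j
    by_cases hjA : j = A.1
    · subst hjA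
      exact heA1 ▸ hh A ha
    by_cases hjB : j = B.1
    · subst hjB
      exact heB1 ▸ hh B ha
    have : e j = u * p j + v * q j := by simp [e, hjA, hjB]
    rw [this]
    exact convex_Icc 0 a (hp.2 j) (hq.2 j) hu hv huv
  have heA : e ∈ A.carrier a := ⟨heA1, hecube⟩
  have heB : e ∈ B.carrier a := ⟨heB1, hecube⟩
  have heC : C.depth a e = u * C.depth a p + v * C.depth a q := by
    obtain ⟨i, b⟩ := C
    cases b
    · simpa [CubeFace.depth] using heC1
    · simp only [CubeFace.depth, if_true] at heC1 ⊢
      rw [heC1]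
      linear_combination -a * huv
  set W := √((B.depth a p + A.depth a q) ^ 2 + (C.depth a p - C.depth a q) ^ 2) with hW
  have hW0 : 0 ≤ W := Real.sqrt_nonneg _
  have hW2 : W ^ 2 = (B.depth a p + A.depth a q) ^ 2 + (C.depth a p - C.depth a q) ^ 2 :=
    Real.sq_sqrt (by positivity)
  have hpe : dist p e = v * W := by
    rw [← sq_eq_sq₀ dist_nonneg (by positivity), dist_sq_eq_depth a hAB hAC hBC, hpA,
      CubeFace.depth_eq_zero heA, CubeFace.depth_eq_zero heB, heC, mul_pow, hW2]
    have hu' : u = 1 - v := by linarith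
    rw [hu']
    linear_combination (B.depth a p + v * (B.depth a p + A.depth a q)) * hur
  have heq : dist e q = u * W := by
    rw [← sq_eq_sq₀ dist_nonneg (by positivity), dist_sq_eq_depth a hAB hAC hBC, hqB,
      CubeFace.depth_eq_zero heA, CubeFace.depth_eq_zero heB, heC, mul_pow, hW2]
    have hv' : v = 1 - u := by linarith
    rw [hv']
    linear_combination (A.depth a q + u * (B.depth a p + A.depth a q)) * hvr
  refine ⟨e, heA, heB, ?_⟩
  rw [hpe, heq, ← add_mul, add_comm v u, huv, one_mul]

/-- The triangle inequality at a vertex, `P` and `Q` being the distances to it. In the unfolding the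
two right-angled corners add up to a straight angle, so the inequality is strict unless both points
lie on the outer edges, where `p₃ = q₃ = 0`. -/
theorem sqrt_add_sq_lt_of_unfold {P Q p₂ p₃ q₁ q₃ : ℝ} (hP : 0 ≤ P) (hQ : 0 ≤ Q)
    (hP2 : P ^ 2 = p₂ ^ 2 + p₃ ^ 2) (hQ2 : Q ^ 2 = q₁ ^ 2 + q₃ ^ 2) (hp₂ : 0 < p₂) (hq₁ : 0 < q₁)
    (hp₃ : 0 ≤ p₃) (hq₃ : 0 ≤ q₃) (h : 0 < p₃ ∨ 0 < q₃) :
    √((p₂ + q₁) ^ 2 + (p₃ - q₃) ^ 2) < P + Q := by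
  have hp : p₂ ≤ P := abs_le_of_sq_le_sq' (by nlinarith) hP |>.2
  have hq : q₁ ≤ Q := abs_le_of_sq_le_sq' (by nlinarith) hQ |>.2
  have key : p₂ * q₁ - p₃ * q₃ < P * Q := by
    have h0 : 0 ≤ p₃ * q₃ := mul_nonneg hp₃ hq₃
    rcases h with h | h
    · have : p₂ < P := lt_of_pow_lt_pow_left₀ 2 hP (by nlinarith)
      nlinarith
    · have : q₁ < Q := lt_of_pow_lt_pow_left₀ 2 hQ (by nlinarith)
      nlinarith
  rw [Real.sqrt_lt' (by linarith)]
  nlinarith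

/-- By Cauchy–Schwarz, `X + Y` is at least the straight distance `√((r + a) ^ 2 + h₂ ^ 2)`.
Exchanging `a` and `h₂` does not increase this, since `r * h₂ ≤ r * a`. -/
theorem sqrt_le_add_of_unfold {a r h₁ h₂ X Y : ℝ} (hX : 0 ≤ X) (hY : 0 ≤ Y)
    (hX2 : X ^ 2 = r ^ 2 + h₁ ^ 2) (hY2 : Y ^ 2 = a ^ 2 + (h₂ - h₁) ^ 2) (hr : 0 ≤ r)
    (hh : h₂ ≤ a) : √((r + h₂) ^ 2 + a ^ 2) ≤ X + Y := by
  have key : r * a + h₁ * (h₂ - h₁) ≤ X * Y := by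
    refine abs_le_of_sq_le_sq' ?_ (mul_nonneg hX hY) |>.2
    rw [mul_pow, hX2, hY2]
    nlinarith [sq_nonneg (r * (h₂ - h₁) - h₁ * a)]
  rw [Real.sqrt_le_left (by positivity)]
  nlinarith [mul_nonneg hr (sub_nonneg.2 hh)]

/-! ### Finite length, and the two forbidden patterns. -/

theorem CubeFace.ne_opposite (F : CubeFace) : F ≠ F.opposite := by
  obtain ⟨i, b⟩ := F
  cases b <;> simp [CubeFace.opposite]

theorem CubeFace.axis_ne_of_ne_opposite {A F : CubeFace} (h : A ≠ F) (h' : A ≠ F.opposite) :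
    F.1 ≠ A.1 := by
  obtain ⟨i, b⟩ := A
  obtain ⟨j, c⟩ := F
  rintro rfl
  cases b <;> cases c <;> simp_all [CubeFace.opposite]

/-- A shortest path between points of two opposite faces has finite length. -/
theorem IsShortestSurfacePath.pathLength_ne_top {a : ℝ} (ha : 0 ≤ a) {F : CubeFace} {s t : Space}
    (hs : s ∈ F.carrier a) (ht : t ∈ F.opposite.carrier a) {γ : Path s t}
    (hγ : IsShortestSurfacePath a γ) : pathLength γ ≠ ⊤ := by
  obtain ⟨j, hj⟩ : ∃ j : Fin 3, j ≠ F.1 := exists_ne _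
  -- Sliding along axis `j` to the lateral face `(j, false)` gives a competitor made of three
  -- segments.
  have key : ∀ (A : CubeFace), j ≠ A.1 → ∀ x ∈ A.carrier a,
      ∃ y, y ∈ A.carrier a ∧ y ∈ CubeFace.carrier a (j, false) := by
    intro A hjA x hx
    let y : Space := WithLp.toLp 2 (Function.update x j 0)
    have hy : ∀ k, y k ∈ Set.Icc 0 a := by
      intro k
      by_cases hk : k = j
      · subst hk
        simp [y, ha]
      · simpa [y, hk] using hx.2 k
    refine ⟨y, ⟨?_, hy⟩, ?_, hy⟩
    · simpa [y, hjA.symm] using hx.1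
    · simp [y, CubeFace.height]
  obtain ⟨p, hp1, hp2⟩ := key F hj s hs
  obtain ⟨q, hq1, hq2⟩ := key F.opposite hj t ht
  have h := hγ.2 (((Path.segment s p).trans (Path.segment p q)).trans (Path.segment q t))
    (isSurfacePath_trans (isSurfacePath_trans (isSurfacePath_segment hs hp1)
      (isSurfacePath_segment hp2 hq2)) (isSurfacePath_segment hq1 ht))
  refine ne_top_of_le_ne_top ?_ (h.trans ((pathLength_trans_le _ _).trans (add_le_add
    ((pathLength_trans_le _ _).trans (add_le_add (pathLength_segment_le _ _)
      (pathLength_segment_le _ _))) (pathLength_segment_le _ _))))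
  finiteness

/-- A shortest path between interior points of faces avoids the vertices of the cube. -/
theorem IsShortestSurfacePath.not_mem_three_carriers {a : ℝ} (ha : 0 < a) {F F' : CubeFace}
    {s t : Space} (hs : s ∈ F.interior a) (ht : t ∈ F'.interior a) {γ : Path s t}
    (hγ : IsShortestSurfacePath a γ) (hfin : pathLength γ ≠ ⊤) (τ : unitInterval)
    {A B C : CubeFace} (hAB : A ≠ B) (hAC : A ≠ C) (hBC : B ≠ C) (hA : γ τ ∈ A.carrier a)
    (hB : γ τ ∈ B.carrier a) (hC : γ τ ∈ C.carrier a) : False := by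
  have hKc : IsCompact (γ ⁻¹' {γ τ}) := (isClosed_singleton.preimage γ.continuous).isCompact
  have hKn : (γ ⁻¹' {γ τ}).Nonempty := ⟨τ, rfl⟩
  -- The first and last times at the vertex are taken, so that the points chosen before and after
  -- differ from it even if the path pauses there.
  obtain ⟨τ₀, h₀, hleast⟩ := hKc.exists_isLeast hKn
  obtain ⟨τ₁, h₁, hgreatest⟩ := hKc.exists_isGreatest hKn
  replace h₀ : γ τ₀ = γ τ := h₀
  replace h₁ : γ τ₁ = γ τ := h₁
  have hpos : 0 < τ₀ := by
    refine lt_of_le_of_ne τ₀.2.1 fun h => hAB ?_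
    have hsv : s = γ τ := by rw [← h₀, ← h, γ.source]
    rw [← hsv] at hA hB
    rw [CubeFace.eq_of_mem_interior ha hs hA, CubeFace.eq_of_mem_interior ha hs hB]
  have hlt : τ₁ < 1 := by
    refine lt_of_le_of_ne τ₁.2.2 fun h => hAB ?_
    have htv : t = γ τ := by rw [← h₁, h, γ.target]
    rw [← htv] at hA hB
    rw [CubeFace.eq_of_mem_interior ha ht hA, CubeFace.eq_of_mem_interior ha ht hB]
  obtain ⟨A', hvA', σ, hσ, hpA'⟩ := hγ.exists_carrier_left hpos
  obtain ⟨B', hvB', ρ, hρ, hqB'⟩ := hγ.exists_carrier_right hlt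
  rw [h₀] at hvA'
  rw [h₁] at hvB'
  have hστ : σ ≤ τ := hσ.le.trans (hleast rfl)
  have hτρ : τ ≤ ρ := (hgreatest rfl : τ ≤ τ₁).trans hρ.le
  have hpv : γ σ ≠ γ τ := fun h => (hleast h).not_gt hσ
  have hqv : γ ρ ≠ γ τ := fun h => (hgreatest h : ρ ≤ τ₁).not_gt hρ
  -- On a common face the path would be straight, with the vertex strictly inside the segment. Then
  -- `γ σ` would lie on all three faces and be the vertex itself.
  have key : ∀ G : CubeFace, γ σ ∈ G.carrier a → γ ρ ∈ G.carrier a → False := by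
    intro G hp hq
    have hseg := hγ.mem_segment hfin hστ hτρ hp hq
    have hmem : ∀ D : CubeFace, γ τ ∈ D.carrier a → γ σ ∈ D.carrier a := fun D hD =>
      CubeFace.mem_carrier_left_of_mem_segment hp.2 hq.2 hseg hD hqv.symm
    have hd := dist_sq_eq_depth a (CubeFace.axis_ne ha hA hB hAB) (CubeFace.axis_ne ha hA hC hAC)
      (CubeFace.axis_ne ha hB hC hBC) (γ σ) (γ τ)
    simp only [CubeFace.depth_eq_zero hA, CubeFace.depth_eq_zero hB, CubeFace.depth_eq_zero hC,
      CubeFace.depth_eq_zero (hmem A hA), CubeFace.depth_eq_zero (hmem B hB),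
      CubeFace.depth_eq_zero (hmem C hC)] at hd
    exact hpv (dist_eq_zero.1 (by simpa using hd))
  have hA'B' : A' ≠ B' := by
    rintro rfl
    exact key _ hpA' hqB'
  obtain ⟨C', hvC', hA'C', hB'C'⟩ : ∃ C', γ τ ∈ C'.carrier a ∧ A' ≠ C' ∧ B' ≠ C' := by
    rcases CubeFace.eq_or_eq_or_eq ha hAB hAC hBC hA hB hC hvA' with rfl | rfl | rfl <;>
      rcases CubeFace.eq_or_eq_or_eq ha hAB hAC hBC hA hB hC hvB' with rfl | rfl | rfl
    · exact absurd rfl hA'B'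
    · exact ⟨C, hC, hAC, hBC⟩
    · exact ⟨B, hB, hAB, hBC.symm⟩
    · exact ⟨C, hC, hBC, hAC⟩
    · exact absurd rfl hA'B'
    · exact ⟨A, hA, hAB.symm, hAC.symm⟩
    · exact ⟨B, hB, hBC.symm, hAB⟩
    · exact ⟨A, hA, hAC.symm, hAB.symm⟩
    · exact absurd rfl hA'B'
  have hx := CubeFace.axis_ne ha hvA' hvB' hA'B'
  have hy := CubeFace.axis_ne ha hvA' hvC' hA'C'
  have hz := CubeFace.axis_ne ha hvB' hvC' hB'C'
  obtain ⟨e, heA, heB, he⟩ := exists_dist_add_dist_le_unfold hx hy hz hpA' hqB'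
  have hle := (hγ.dist_add_dist_le hfin hστ hτρ hpA' heA heB hqB').trans he
  refine hle.not_gt (sqrt_add_sq_lt_of_unfold dist_nonneg dist_nonneg ?_ ?_ ?_ ?_ ?_ ?_ ?_)
  · rw [dist_sq_eq_depth a hx hy hz, CubeFace.depth_eq_zero hvA', CubeFace.depth_eq_zero hvB',
      CubeFace.depth_eq_zero hvC', CubeFace.depth_eq_zero hpA']
    ring
  · rw [dist_sq_eq_depth a hx hy hz, CubeFace.depth_eq_zero hvA', CubeFace.depth_eq_zero hvB',
      CubeFace.depth_eq_zero hvC', CubeFace.depth_eq_zero hqB']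
    ring
  · exact CubeFace.depth_pos hpA'.2 fun h => key _ h hqB'
  · exact CubeFace.depth_pos hqB'.2 fun h => key _ hpA' h
  · exact CubeFace.depth_nonneg hpA'.2 _
  · exact CubeFace.depth_nonneg hqB'.2 _
  · by_cases h : γ σ ∈ C'.carrier a
    · exact Or.inr (CubeFace.depth_pos hqB'.2 fun h' => key _ h h')
    · exact Or.inl (CubeFace.depth_pos hpA'.2 h)

/-- A shortest path that starts in the interior of `F` and leaves `F` through an edge of the
adjacent face `G` does not go on to cross the next face `H` up to its edge opposite to `G`:
going from `F` to `H` directly is no longer. -/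
theorem IsShortestSurfacePath.not_cross_two_sides {a : ℝ} (ha : 0 < a) {F G H K : CubeFace}
    {s t : Space} (hs : s ∈ F.interior a) {γ : Path s t} (hγ : IsShortestSurfacePath a γ)
    (hfin : pathLength γ ≠ ⊤) {σ ρ τ : unitInterval} (hσρ : σ ≤ ρ) (hρτ : ρ ≤ τ)
    (hFG : F.1 ≠ G.1) (hFH : F.1 ≠ H.1) (hGH : G.1 ≠ H.1) (hGK : G ≠ K) (hGK' : G.1 = K.1)
    (hσF : γ σ ∈ F.carrier a) (hσG : γ σ ∈ G.carrier a) (hσH : γ σ ∉ H.carrier a)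
    (hρG : γ ρ ∈ G.carrier a) (hρH : γ ρ ∈ H.carrier a)
    (hτH : γ τ ∈ H.carrier a) (hτK : γ τ ∈ K.carrier a) : False := by
  have hs0 : γ 0 ∈ F.interior a := by rwa [γ.source]
  have hs0' := F.interior_subset_carrier ha.le hs0
  have hτG : G.depth a (γ τ) = a := by
    have := CubeFace.depth_add_depth (a := a) hGK hGK' (γ τ)
    rwa [CubeFace.depth_eq_zero hτK, add_zero] at this
  obtain ⟨e, heF, heH, he⟩ := exists_dist_add_dist_le_unfold hFH hFG hGH.symm hσF hτH
  rw [CubeFace.depth_eq_zero hσG, hτG, zero_sub, neg_sq] at he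
  have h1 := hγ.dist_add_dist_add_dist_le hfin σ.2.1 hσρ hρτ hs0' heF heH hτH
  have h2 := sqrt_le_add_of_unfold (a := a) (r := H.depth a (γ σ)) (h₁ := F.depth a (γ ρ))
    (h₂ := F.depth a (γ τ)) (X := dist (γ σ) (γ ρ)) (Y := dist (γ ρ) (γ τ)) dist_nonneg
    dist_nonneg
    (by
      rw [dist_sq_eq_depth a hFH hFG hGH.symm, CubeFace.depth_eq_zero hσF,
        CubeFace.depth_eq_zero hσG, CubeFace.depth_eq_zero hρG, CubeFace.depth_eq_zero hρH]
      ring)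
    (by
      rw [dist_sq_eq_depth a hFH hFG hGH.symm, hτG, CubeFace.depth_eq_zero hρG,
        CubeFace.depth_eq_zero hρH, CubeFace.depth_eq_zero hτH]
      ring)
    (CubeFace.depth_nonneg hσF.2 _) (CubeFace.depth_le hτH.2 _)
  -- The detour through `e` from `γ σ` is no longer than the path, and the detour from `γ 0` is no
  -- shorter. Comparing the two forces equality in the triangle inequality for `γ 0`, `γ σ`, `e`.
  have hseg : γ σ ∈ segment ℝ (γ 0) e := by
    rw [mem_segment_iff_wbtw, ← dist_add_dist_eq_iff]
    exact le_antisymm (by linarith) (dist_triangle _ _ _)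
  have hne : γ σ ≠ e := fun h => hσH (h ▸ heH)
  have h0G := CubeFace.mem_carrier_left_of_mem_segment hs0'.2 heF.2 hseg hσG hne
  exact hFG (congrArg Prod.fst (CubeFace.eq_of_mem_interior ha hs0 h0G)).symm

/-- A face that a shortest path meets between two points of one face contains one of these
points. -/
theorem IsShortestSurfacePath.mem_carrier_or {a : ℝ} {s t : Space} {γ : Path s t}
    (hγ : IsShortestSurfacePath a γ) (hfin : pathLength γ ≠ ⊤) {σ ρ τ : unitInterval}
    (hσρ : σ ≤ ρ) (hρτ : ρ ≤ τ) {A G : CubeFace} (hA : γ σ ∈ A.carrier a)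
    (hB : γ τ ∈ A.carrier a) (hG : γ ρ ∈ G.carrier a) :
    γ σ ∈ G.carrier a ∨ γ τ ∈ G.carrier a := by
  by_cases h : γ ρ = γ τ
  · exact Or.inr (h ▸ hG)
  · exact Or.inl (CubeFace.mem_carrier_left_of_mem_segment hA.2 hB.2
      (hγ.mem_segment hfin hσρ hρτ hA hB) hG h)

/-! ### Counting faces and assembling the itinerary. -/

/-- Makes `k` unique for a given path, so that three or four excludes five and six. -/
theorem TraversesExactly.eq_ncard {a : ℝ} {s t : Space} {γ : Path s t} {k : ℕ}
    (h : TraversesExactly a γ k) : k = {G : CubeFace | ∃ τ, γ τ ∈ G.carrier a}.ncard := by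
  obtain ⟨F, b, hF, hb, -, -, hin, -, hout⟩ := h
  have : {G : CubeFace | ∃ τ, γ τ ∈ G.carrier a} = Set.range F := by
    ext G
    refine ⟨hout G, ?_⟩
    rintro ⟨i, rfl⟩
    exact ⟨b i.castSucc, hin i _ (Set.left_mem_Icc.2 (hb i.castSucc_lt_succ).le)⟩
  rw [this, Set.ncard_eq_toFinset_card', Set.toFinset_range, Finset.card_image_of_injective _ hF]
  simp

theorem injective_vec_three {α : Type*} {x y z : α} (hxy : x ≠ y) (hxz : x ≠ z) (hyz : y ≠ z) :
    Function.Injective ![x, y, z] := by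
  intro i j hij
  fin_cases i <;> fin_cases j <;> simp_all [eq_comm]

theorem injective_vec_four {α : Type*} {x y z w : α} (hxy : x ≠ y) (hxz : x ≠ z) (hxw : x ≠ w)
    (hyz : y ≠ z) (hyw : y ≠ w) (hzw : z ≠ w) : Function.Injective ![x, y, z, w] := by
  intro i j hij
  fin_cases i <;> fin_cases j <;> simp_all [eq_comm]

theorem IsShortestSurfacePath.traversesExactly_three_or_four {a : ℝ} (ha : 0 < a) {F : CubeFace}
    {s t : Space} (hs : s ∈ F.interior a) (ht : t ∈ F.opposite.interior a) {γ : Path s t}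
    (hγ : IsShortestSurfacePath a γ) : TraversesExactly a γ 3 ∨ TraversesExactly a γ 4 := by
  have hfin := hγ.pathLength_ne_top ha.le (F.interior_subset_carrier ha.le hs)
    (F.opposite.interior_subset_carrier ha.le ht)
  have h0 : γ 0 ∈ F.interior a := by rwa [γ.source]
  have h1 : γ 1 ∈ F.opposite.interior a := by rwa [γ.target]
  have h0' := F.interior_subset_carrier ha.le h0
  have h1' := F.opposite.interior_subset_carrier ha.le h1
  have hopp : ∀ τ, γ τ ∈ F.carrier a → γ τ ∈ F.opposite.carrier a → False := fun τ h h' =>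
    CubeFace.axis_ne ha h h' F.ne_opposite rfl
  have two : ∀ τ (A B C : CubeFace), A ≠ B → γ τ ∈ A.carrier a → γ τ ∈ B.carrier a →
      γ τ ∈ C.carrier a → C = A ∨ C = B := by
    intro τ A B C hAB hA hB hC
    by_contra! h
    exact hγ.not_mem_three_carriers ha hs ht hfin τ hAB h.1.symm h.2.symm hA hB hC
  have hK : ∀ A : CubeFace, IsCompact (γ ⁻¹' A.carrier a) := fun A =>
    ((A.isClosed_carrier a).preimage γ.continuous).isCompact
  obtain ⟨β, hβF, hβ⟩ := (hK F).exists_isGreatest ⟨0, h0'⟩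
  obtain ⟨θ, hθF, hθ⟩ := (hK F.opposite).exists_isLeast ⟨1, h1'⟩
  have hβθ : β < θ := by
    by_contra! h
    exact hopp θ (hγ.mem_carrier hfin θ.2.1 h h0' hβF) hθF
  have side : ∀ σ, β ≤ σ → σ < θ → ∃ A : CubeFace, A ≠ F ∧ A ≠ F.opposite ∧ γ σ ∈ A.carrier a ∧
      ∃ τ, σ < τ ∧ γ τ ∈ A.carrier a := by
    intro σ hβσ hσθ
    obtain ⟨A, hA, τ, hτ, hAτ⟩ := hγ.exists_carrier_right (hσθ.trans_le θ.2.2)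
    refine ⟨A, ?_, ?_, hA, τ, hτ, hAτ⟩
    · rintro rfl
      exact (hβ hAτ).not_gt (hβσ.trans_lt hτ)
    · rintro rfl
      exact (hθ hA).not_gt hσθ
  have hβ0 : 0 < β := by
    obtain ⟨A, hAF, -, hA, -⟩ := side β le_rfl hβθ
    refine lt_of_le_of_ne β.2.1 fun h => hAF ?_
    rw [← h] at hA
    exact CubeFace.eq_of_mem_interior ha h0 hA
  have hθ1 : θ < 1 := by
    obtain ⟨A, hA, τ, hτ, hAτ⟩ := hγ.exists_carrier_left (β.2.1.trans_lt hβθ)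
    refine lt_of_le_of_ne θ.2.2 fun h => (hθ (?_ : γ τ ∈ F.opposite.carrier a)).not_gt hτ
    rw [h] at hA
    exact CubeFace.eq_of_mem_interior ha h1 hA ▸ hAτ
  obtain ⟨G, hGF, hGF', hβG, τ₁, hτ₁, hτ₁G⟩ := side β le_rfl hβθ
  obtain ⟨β₁, hβ₁G, hβ₁⟩ := (hK G).exists_isGreatest ⟨β, hβG⟩
  have hββ₁ : β < β₁ := hτ₁.trans_le (hβ₁ hτ₁G)
  have first : ∀ τ C, τ ≤ β → γ τ ∈ CubeFace.carrier a C → C = F ∨ C = G := by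
    intro τ C hτ hC
    rcases hγ.mem_carrier_or hfin τ.2.1 hτ h0' hβF hC with h | h
    · exact Or.inl (CubeFace.eq_of_mem_interior ha h0 h)
    · exact two β F G C hGF.symm hβF hβG h
  -- The alternative between three and four faces: whether the first lateral face `G` lasts until
  -- the opposite face is reached.
  by_cases hθG : γ θ ∈ G.carrier a
  · left
    have second : ∀ τ C, β ≤ τ → τ ≤ θ → γ τ ∈ CubeFace.carrier a C →
        C = F ∨ C = G ∨ C = F.opposite := by
      intro τ C hτ hτ' hC
      rcases hγ.mem_carrier_or hfin hτ hτ' hβG hθG hC with h | h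
      · rcases two β F G C hGF.symm hβF hβG h with h | h <;> simp [h]
      · rcases two θ G F.opposite C hGF' hθG hθF h with h | h <;> simp [h]
    have third : ∀ τ C, θ ≤ τ → γ τ ∈ CubeFace.carrier a C → C = G ∨ C = F.opposite := by
      intro τ C hτ hC
      rcases hγ.mem_carrier_or hfin hτ τ.2.2 hθF h1' hC with h | h
      · exact two θ G F.opposite C hGF' hθG hθF h
      · exact Or.inr (CubeFace.eq_of_mem_interior ha h1 h)
    refine ⟨![F, G, F.opposite], ![0, β, θ, 1], ?_, ?_, rfl, rfl, ?_, ?_, ?_⟩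
    · exact injective_vec_three hGF.symm F.ne_opposite hGF'
    · rw [Fin.strictMono_iff_lt_succ]
      intro i
      fin_cases i
      exacts [hβ0, hβθ, hθ1]
    · intro i τ hτ
      fin_cases i
      · exact hγ.mem_carrier hfin hτ.1 hτ.2 h0' hβF
      · exact hγ.mem_carrier hfin hτ.1 hτ.2 hβG hθG
      · exact hγ.mem_carrier hfin hτ.1 hτ.2 hθF h1'
    · intro i
      fin_cases i
      · exact ⟨0, ⟨le_rfl, hβ0.le⟩, h0⟩
      · obtain ⟨τ, hτ, hτ'⟩ := exists_between hβθ
        refine ⟨τ, ⟨hτ.le, hτ'.le⟩, CubeFace.mem_interior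
          (hγ.mem_carrier hfin hτ.le hτ'.le hβG hθG) fun C hC => ?_⟩
        rcases second τ C hτ.le hτ'.le hC with rfl | h | rfl
        · exact absurd hτ (hβ hC).not_gt
        · exact h
        · exact absurd hτ' (hθ hC).not_gt
      · exact ⟨1, ⟨hθ1.le, le_rfl⟩, h1⟩
    · rintro C ⟨τ, hC⟩
      have hcases : C = F ∨ C = G ∨ C = F.opposite := by
        rcases le_total τ β with h | h
        · rcases first τ C h hC with h | h <;> simp [h]
        rcases le_total τ θ with h' | h'
        · exact second τ C h h' hC
        · rcases third τ C h' hC with h | h <;> simp [h]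
      rcases hcases with rfl | rfl | rfl
      exacts [⟨0, rfl⟩, ⟨1, rfl⟩, ⟨2, rfl⟩]
  · right
    have hβ₁θ : β₁ < θ := by
      by_contra! h
      exact hθG (hγ.mem_carrier hfin hβθ.le h hβG hβ₁G)
    obtain ⟨H, hHF, hHF', hβ₁H, τ₂, hτ₂, hτ₂H⟩ := side β₁ hββ₁.le hβ₁θ
    have hGH : G ≠ H := by
      rintro rfl
      exact (hβ₁ hτ₂H).not_gt hτ₂
    have hβH : γ β ∉ H.carrier a := fun h =>
      hγ.not_mem_three_carriers ha hs ht hfin β hGF.symm hHF.symm hGH hβF hβG h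
    have hGH' := CubeFace.axis_ne ha hβ₁G hβ₁H hGH
    have hθH : γ θ ∈ H.carrier a := by
      by_contra hθH
      obtain ⟨β₂, hβ₂H, hβ₂⟩ := (hK H).exists_isGreatest ⟨β₁, hβ₁H⟩
      have hβ₁β₂ : β₁ < β₂ := hτ₂.trans_le (hβ₂ hτ₂H)
      have hβ₂θ : β₂ < θ := by
        by_contra! h
        exact hθH (hγ.mem_carrier hfin hβ₁θ.le h hβ₁H hβ₂H)
      obtain ⟨K, hKF, hKF', hβ₂K, τ₃, hτ₃, hτ₃K⟩ := side β₂ (hββ₁.trans hβ₁β₂).le hβ₂θ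
      have hHK : H ≠ K := by
        rintro rfl
        exact (hβ₂ hτ₃K).not_gt hτ₃
      have hGK : G ≠ K := by
        rintro rfl
        exact (hβ₁ hβ₂K).not_gt hβ₁β₂
      have hHK' := CubeFace.axis_ne ha hβ₂H hβ₂K hHK
      have hFG' := CubeFace.axis_ne_of_ne_opposite hGF hGF'
      have hFH' := CubeFace.axis_ne_of_ne_opposite hHF hHF'
      have hFK' := CubeFace.axis_ne_of_ne_opposite hKF hKF'
      -- The axis of `K` differs from those of `F` and `H`, so it is the axis of `G`: `K` is
      -- opposite `G`.
      exact hγ.not_cross_two_sides ha hs hfin hββ₁.le hβ₁β₂.le hFG' hFH' hGH' hGK (by omega)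
        hβF hβG hβH hβ₁G hβ₁H hβ₂H hβ₂K
    have second : ∀ τ C, β ≤ τ → τ ≤ β₁ → γ τ ∈ CubeFace.carrier a C →
        C = F ∨ C = G ∨ C = H := by
      intro τ C hτ hτ' hC
      rcases hγ.mem_carrier_or hfin hτ hτ' hβG hβ₁G hC with h | h
      · rcases two β F G C hGF.symm hβF hβG h with h | h <;> simp [h]
      · rcases two β₁ G H C hGH hβ₁G hβ₁H h with h | h <;> simp [h]
    have third : ∀ τ C, β₁ ≤ τ → τ ≤ θ → γ τ ∈ CubeFace.carrier a C →
        C = G ∨ C = H ∨ C = F.opposite := by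
      intro τ C hτ hτ' hC
      rcases hγ.mem_carrier_or hfin hτ hτ' hβ₁H hθH hC with h | h
      · rcases two β₁ G H C hGH hβ₁G hβ₁H h with h | h <;> simp [h]
      · rcases two θ H F.opposite C hHF' hθH hθF h with h | h <;> simp [h]
    have fourth : ∀ τ C, θ ≤ τ → γ τ ∈ CubeFace.carrier a C → C = H ∨ C = F.opposite := by
      intro τ C hτ hC
      rcases hγ.mem_carrier_or hfin hτ τ.2.2 hθF h1' hC with h | h
      · exact two θ H F.opposite C hHF' hθH hθF h
      · exact Or.inr (CubeFace.eq_of_mem_interior ha h1 h)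
    refine ⟨![F, G, H, F.opposite], ![0, β, β₁, θ, 1], ?_, ?_, rfl, rfl, ?_, ?_, ?_⟩
    · exact injective_vec_four hGF.symm hHF.symm F.ne_opposite hGH hGF' hHF'
    · rw [Fin.strictMono_iff_lt_succ]
      intro i
      fin_cases i
      exacts [hβ0, hββ₁, hβ₁θ, hθ1]
    · intro i τ hτ
      fin_cases i
      · exact hγ.mem_carrier hfin hτ.1 hτ.2 h0' hβF
      · exact hγ.mem_carrier hfin hτ.1 hτ.2 hβG hβ₁G
      · exact hγ.mem_carrier hfin hτ.1 hτ.2 hβ₁H hθH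
      · exact hγ.mem_carrier hfin hτ.1 hτ.2 hθF h1'
    · intro i
      fin_cases i
      · exact ⟨0, ⟨le_rfl, hβ0.le⟩, h0⟩
      · obtain ⟨α, hαH, hα⟩ := (hK H).exists_isLeast ⟨β₁, hβ₁H⟩
        have hβα : β < α := by
          by_contra! h
          exact hβH (hγ.mem_carrier hfin h hββ₁.le hαH hβ₁H)
        obtain ⟨τ, hτ, hτ'⟩ := exists_between hβα
        have hτβ₁ : τ ≤ β₁ := hτ'.le.trans (hα hβ₁H)
        refine ⟨τ, ⟨hτ.le, hτβ₁⟩, CubeFace.mem_interior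
          (hγ.mem_carrier hfin hτ.le hτβ₁ hβG hβ₁G) fun C hC => ?_⟩
        rcases second τ C hτ.le hτβ₁ hC with rfl | h | rfl
        · exact absurd hτ (hβ hC).not_gt
        · exact h
        · exact absurd hτ' (hα hC).not_gt
      · obtain ⟨τ, hτ, hτ'⟩ := exists_between hβ₁θ
        refine ⟨τ, ⟨hτ.le, hτ'.le⟩, CubeFace.mem_interior
          (hγ.mem_carrier hfin hτ.le hτ'.le hβ₁H hθH) fun C hC => ?_⟩
        rcases third τ C hτ.le hτ'.le hC with rfl | h | rfl
        · exact absurd hτ (hβ₁ hC).not_gt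
        · exact h
        · exact absurd hτ' (hθ hC).not_gt
      · exact ⟨1, ⟨hθ1.le, le_rfl⟩, h1⟩
    · rintro C ⟨τ, hC⟩
      have hcases : C = F ∨ C = G ∨ C = H ∨ C = F.opposite := by
        rcases le_total τ β with h | h
        · rcases first τ C h hC with h | h <;> simp [h]
        rcases le_total τ β₁ with h' | h'
        · rcases second τ C h h' hC with h | h | h <;> simp [h]
        rcases le_total τ θ with h'' | h''
        · rcases third τ C h' h'' hC with h | h | h <;> simp [h]
        · rcases fourth τ C h'' hC with h | h <;> simp [h]
      rcases hcases with rfl | rfl | rfl | rfl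
      exacts [⟨0, rfl⟩, ⟨1, rfl⟩, ⟨2, rfl⟩, ⟨3, rfl⟩]

theorem mainTheorem1 (a : ℝ) (ha : 0 < a) (F : CubeFace) (s t : Space)
    (hs : s ∈ F.interior a) (ht : t ∈ F.opposite.interior a)
    (γ : Path s t) (hγ : IsShortestSurfacePath a γ) :
    (TraversesExactly a γ 3 ∨ TraversesExactly a γ 4) ∧
      ¬ TraversesExactly a γ 5 ∧ ¬ TraversesExactly a γ 6 := by
  have h := hγ.traversesExactly_three_or_four ha hs ht
  refine ⟨h, fun h' => ?_, fun h' => ?_⟩ <;> rcases h with h | h <;>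
    exact absurd (h.eq_ncard.trans h'.eq_ncard.symm) (by norm_num)
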